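/- Let $k\ge 2$ and let $\mathcal H$ be a connected $k$-uniform hypergraph (without repeated edges) with at least one edge and with finite vertex set $V$; let $d_i$ be the degree of $i\in V$, i.e. the number of edges containing $i$. The adjacency tensor $\mathcal A_{\mathcal H}=(a_{i_1\cdots i_k})$ is the order $k$ tensor with indices in $V$ whose entry is $a_{i_1\cdots i_k}=\frac1{(k-1)!}$ if $\{i_1,\dots,i_k\}$ is an edge of $\mathcal H$, and $0$ otherwise. The signless Laplacian tensor is $\mathcal Q_{\mathcal H}=\mathcal D_{\mathcal H}+\mathcal A_{\mathcal H}$, where $\mathcal D_{\mathcal H}$ is the diagonal tensor of order $k$ with $(i,\dots,i)$-entry $d_i$. For a tensor $\mathcal T=(t_{i_1\cdots i_k})$ of order $k$ with indices in $V$, a number $\lambda\in\mathbb C$ is an eigenvalue if there is a nonzero $x\in\mathbb C^V$ with $\sum_{i_2,\dots,i_k\in V}t_{i i_2\cdots i_k}x_{i_2}\cdots x_{i_k}=\lambda x_i^{k-1}$ for all $i\in V$, and $\rho(\mathcal T)=\sup\{|\lambda| : \lambda\text{ an eigenvalue of }\mathcal T\}$. The digraph $G_{\mathcal T}$ has vertex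 set $V$ and an arc $(i,j)$ whenever $t_{i i_2\cdots i_k}\ne 0$ for some $i_2,\dots,i_k$ with $j\in\{i_2,\dots,i_k\}$. Let $C(G_{\mathcal T})$ be the set of its circuits, i.e. directed closed paths with distinct vertices (loops are circuits of length $1$), and let $|\gamma|$ be the length of the circuit $\gamma$. Then $$\min_{\gamma\in C(G_{\mathcal A_{\mathcal H}})}\Big(\prod_{i\in\gamma}d_i\Big)^{1/|\gamma|}\le\rho(\mathcal A_{\mathcal H})\le\max_{\gamma\in C(G_{\mathcal A_{\mathcal H}})}\Big(\prod_{i\in\gamma}d_i\Big)^{1/|\gamma|}$$ and $$\min_{\gamma\in C(G_{\mathcal Q_{\mathcal H}})}\Big(\prod_{i\in\gamma}2d_i\Big)^{1/|\gamma|}\le\rho(\mathcal Q_{\mathcal H})\le\max_{\gamma\in C(G_{\mathcal Q_{\mathcal H}})}\Big(\prod_{i\in\gamma}2d_i\Big)^{1/|\gamma|}.$$ In particular, both sets of circuits are nonempty and these minima and maxima exist. -/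

import Mathlib

open scoped Nat

/-- Tensors `a = (a_{i₁ i₂ ⋯ i_m})` of order `m ≥ 1` over `R` with indices ranging over `ι`.
The entry `a_{i₁ i₂ ⋯ i_m}` is `a i₁ g`, where `g = (i₂, …, i_m)`. -/
abbrev Tensor (R : Type*) (m : ℕ) (ι : Type*) : Type _ := ι → (Fin (m - 1) → ι) → R

namespace Tensor

variable {m : ℕ} {ι : Type*}

/-- The vector `A x^{m-1}`, with entries `∑_{i₂,…,i_m} a_{i i₂ ⋯ i_m} x_{i₂} ⋯ x_{i_m}`. -/
noncomputable def applyVec [Fintype ι] (A : Tensor ℂ m ι) (x : ι → ℂ) : ι → ℂ :=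
  fun i => ∑ g : Fin (m - 1) → ι, A i g * ∏ j, x (g j)

/-- `μ` is an eigenvalue of `A`: `A x^{m-1} = μ x^{[m-1]}` for some nonzero complex vector `x`. -/
def IsEigenvalue [Fintype ι] (A : Tensor ℂ m ι) (μ : ℂ) : Prop :=
  ∃ x : ι → ℂ, x ≠ 0 ∧ ∀ i, A.applyVec x i = μ * x i ^ (m - 1)

/-- The spectral radius: the supremum of the moduli of all eigenvalues. -/
noncomputable def spectralRadius [Fintype ι] (A : Tensor ℂ m ι) : ℝ :=
  sSup {r : ℝ | ∃ μ : ℂ, A.IsEigenvalue μ ∧ r = ‖μ‖}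

/-- The digraph of a tensor: there is an arc `(i, j)` (possibly a loop) iff some entry
`a_{i i₂ ⋯ i_m}` with `j ∈ {i₂, …, i_m}` is nonzero. -/
def digraph (A : Tensor ℂ m ι) : Digraph ι where
  Adj i j := ∃ g : Fin (m - 1) → ι, A i g ≠ 0 ∧ j ∈ Set.range g

end Tensor

namespace Digraph

variable {V : Type*}

/-- The circuits of a digraph: nonempty cyclic sequences of distinct vertices in which each vertex
has an arc to the next one, the last one having an arc to the first. A loop is a circuit of
length one. -/
def circuits (G : Digraph V) : Set (Cycle V) :=
  {c | c ≠ Cycle.nil ∧ c.Nodup ∧ c.Chain G.Adj}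

end Digraph

/-- `(∏_{i ∈ γ} f i)^{1/|γ|}`, where `|γ|` is the length of `γ`. -/
noncomputable def Cycle.geomMean {V : Type*} (γ : Cycle V) (f : V → ℝ) : ℝ :=
  (γ.toMultiset.map f).prod ^ (1 / (γ.length : ℝ))

namespace Hypergraph

variable {α : Type*}

/-- Every edge has exactly `k` vertices. -/
def IsUniform (H : Hypergraph α) (k : ℕ) : Prop :=
  ∀ e ∈ H.edgeSet, e.encard = k

/-- There is a vertex, and any two vertices are joined by a chain of vertices in which consecutive
ones lie in a common edge. -/
def IsConnected (H : Hypergraph α) : Prop :=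
  H.vertexSet.Nonempty ∧
    ∀ u ∈ H.vertexSet, ∀ v ∈ H.vertexSet, Relation.ReflTransGen H.Adj u v

/-- The number of edges that contain `v` (meant for hypergraphs with finitely many edges). -/
noncomputable def degree (H : Hypergraph α) (v : α) : ℕ :=
  {e | e ∈ H.edgeSet ∧ v ∈ e}.ncard

open Classical in
/-- The adjacency tensor of a `k`-uniform hypergraph: the entry at `(i₁, …, i_k)` is `1 / (k-1)!`
if `{i₁, …, i_k}` is an edge, and `0` otherwise. -/
noncomputable def adjacencyTensor (H : Hypergraph α) (k : ℕ) : Tensor ℂ k H.vertexSet :=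
  fun i g =>
    if insert (i : α) (Set.range fun j => (g j : α)) ∈ H.edgeSet then 1 / ((k - 1)! : ℂ) else 0

open Classical in
/-- The degree tensor: the diagonal tensor of order `k` with diagonal entries the degrees. -/
noncomputable def degreeTensor (H : Hypergraph α) (k : ℕ) : Tensor ℂ k H.vertexSet :=
  fun i g => if ∀ j, g j = i then (H.degree i : ℂ) else 0

/-- The signless Laplacian tensor. -/
noncomputable def signlessLaplacianTensor (H : Hypergraph α) (k : ℕ) : Tensor ℂ k H.vertexSet :=
  H.degreeTensor k + H.adjacencyTensor k

end Hypergraph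

/-!
The rows of the adjacency tensor sum to the degrees `d_i`, those of the signless Laplacian tensor to
`2 d_i`, so both estimates are instances of one estimate for a nonnegative tensor `A` with positive
row sums `r_i` and with a positive eigenvector.

*Upper bound.* Let `A x^{m-1} = μ x^{[m-1]}` with `x ≠ 0`, and let `σ i` be an out-neighbour of `i`
at which `|x|` is largest. The eigenvalue equation gives `|μ| |x_i|^{m-1} ≤ r_i |x_{σ i}|^{m-1}`.
If `μ ≠ 0`, then starting from a nonzero coordinate the iterates of `σ` stay at nonzero coordinates
and reach a periodic orbit `γ`; multiplying along `γ`, the coordinates of `x` cancel and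
`|μ|^{|γ|} ≤ ∏_{i ∈ γ} r_i` (`Tensor.exists_circuit_le_geomMean`).

*Lower bound.* If `x` is positive and `σ i` is an out-neighbour at which `x` is smallest, the same
argument with reversed inequalities gives `∏_{i ∈ γ} r_i ≤ μ^{|γ|}`
(`Tensor.exists_circuit_geomMean_le`).

*Positive eigenvector.* Perron–Frobenius theory is replaced by a variational argument, possible
because the tensors are symmetric. On the simplex, let `x` maximise the ratio of
`∑_e ∏_{j ∈ e} x_j + (1/k) ∑_i w_i x_i^k` to `∑_i x_i^k`. If some but not all coordinates of `x`
vanished, connectedness would give an edge with coordinates of both kinds; raising the zero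
coordinates to `ε` gains at least a multiple of `ε^{k-1}` and costs at most a multiple of `ε^k`,
which contradicts maximality (`pos_of_isMaxOn_zero`). So `x` is positive, and the vanishing of the
partial derivatives is the eigenvalue equation (`exists_pos_eigenvector`); take `w = 0` for the
adjacency tensor and `w = d` for the signless Laplacian.
-/

/-! ### Geometric means along periodic orbits -/

open Function in
theorem exists_mem_periodicPts_iterate {V : Type*} [Finite V] (σ : V → V) (i : V) :
    ∃ n, σ^[n] i ∈ periodicPts σ := by
  obtain ⟨a, b, hab, h⟩ := Finite.exists_ne_map_eq_of_infinite (fun n : ℕ => σ^[n] i)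
  wlog hlt : a < b generalizing a b
  · exact this b a hab.symm h.symm (by omega)
  refine ⟨a, mk_mem_periodicPts (n := b - a) (by omega) ?_⟩
  change σ^[b - a] (σ^[a] i) = σ^[a] i
  rw [← iterate_add_apply, Nat.sub_add_cancel hlt.le]
  exact h.symm

namespace Cycle

open Function

variable {V : Type*}

theorem geomMean_periodicOrbit (σ : V → V) (i : V) (f : V → ℝ) :
    (periodicOrbit σ i).geomMean f =
      (∏ n ∈ Finset.range (minimalPeriod σ i), f (σ^[n] i)) ^ (1 / (minimalPeriod σ i : ℝ)) := by
  rw [geomMean, periodicOrbit_length, periodicOrbit_def, coe_toMultiset, Multiset.map_coe,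
    List.map_map, Multiset.prod_coe, Finset.prod_eq_multiset_prod, Finset.range_val,
    ← Multiset.coe_range, Multiset.map_coe, Multiset.prod_coe]
  rfl

theorem geomMean_nonneg {γ : Cycle V} {f : V → ℝ} (hf : ∀ i, 0 ≤ f i) : 0 ≤ γ.geomMean f := by
  refine Real.rpow_nonneg (Multiset.prod_nonneg fun a ha => ?_) _
  obtain ⟨i, -, rfl⟩ := Multiset.mem_map.1 ha
  exact hf i

/-- Along a periodic orbit of `σ`, the products of `x` and of `x ∘ σ` agree. -/
theorem prod_range_minimalPeriod_succ (σ : V → V) (i : V) (x : V → ℝ) :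
    ∏ n ∈ Finset.range (minimalPeriod σ i), x (σ^[n + 1] i) =
      ∏ n ∈ Finset.range (minimalPeriod σ i), x (σ^[n] i) := by
  cases h : minimalPeriod σ i with
  | zero => simp
  | succ p =>
    have hp : σ^[p + 1] i = i := h ▸ iterate_minimalPeriod
    rw [Finset.prod_range_succ, Finset.prod_range_succ' (fun n => x (σ^[n] i)), hp]
    rfl

/-- Multiplying the inequalities along the orbit cancels `x`. Positivity of `x` is needed only on
the orbit, as the eigenvector in the upper bound may have zero coordinates elsewhere. -/
theorem le_geomMean_periodicOrbit {σ : V → V} {i : V} (hi : i ∈ periodicPts σ)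
    {f x : V → ℝ} {a : ℝ} (ha : 0 ≤ a) (hx : ∀ n, 0 < x (σ^[n] i))
    (h : ∀ n, a * x (σ^[n] i) ≤ f (σ^[n] i) * x (σ^[n + 1] i)) :
    a ≤ (periodicOrbit σ i).geomMean f := by
  have hp := minimalPeriod_pos_of_mem_periodicPts hi
  have hpos : 0 < ∏ n ∈ Finset.range (minimalPeriod σ i), x (σ^[n] i) :=
    Finset.prod_pos fun n _ => hx n
  have key : a ^ minimalPeriod σ i ≤ ∏ n ∈ Finset.range (minimalPeriod σ i), f (σ^[n] i) := by
    refine le_of_mul_le_mul_right ?_ hpos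
    calc _ = ∏ n ∈ Finset.range (minimalPeriod σ i), a * x (σ^[n] i) := by
          rw [Finset.prod_mul_distrib, Finset.prod_const, Finset.card_range]
      _ ≤ ∏ n ∈ Finset.range (minimalPeriod σ i), f (σ^[n] i) * x (σ^[n + 1] i) :=
          Finset.prod_le_prod (fun n _ => mul_nonneg ha (hx n).le) fun n _ => h n
      _ = _ := by rw [Finset.prod_mul_distrib, prod_range_minimalPeriod_succ]
  rw [geomMean_periodicOrbit, one_div]
  calc a = (a ^ minimalPeriod σ i) ^ ((minimalPeriod σ i : ℝ)⁻¹) :=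
        (Real.pow_rpow_inv_natCast ha hp.ne').symm
    _ ≤ _ := Real.rpow_le_rpow (by positivity) key (by positivity)

/-- The reverse of `Cycle.le_geomMean_periodicOrbit`. -/
theorem geomMean_periodicOrbit_le {σ : V → V} {i : V} (hi : i ∈ periodicPts σ)
    {f x : V → ℝ} {a : ℝ} (ha : 0 ≤ a) (hf : ∀ j, 0 ≤ f j) (hx : ∀ j, 0 < x j)
    (h : ∀ j, f j * x (σ j) ≤ a * x j) :
    (periodicOrbit σ i).geomMean f ≤ a := by
  have hp := minimalPeriod_pos_of_mem_periodicPts hi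
  have hpos : 0 < ∏ n ∈ Finset.range (minimalPeriod σ i), x (σ^[n] i) :=
    Finset.prod_pos fun n _ => hx _
  have key : ∏ n ∈ Finset.range (minimalPeriod σ i), f (σ^[n] i) ≤ a ^ minimalPeriod σ i := by
    refine le_of_mul_le_mul_right ?_ hpos
    calc _ = ∏ n ∈ Finset.range (minimalPeriod σ i), f (σ^[n] i) * x (σ^[n + 1] i) := by
          rw [Finset.prod_mul_distrib, prod_range_minimalPeriod_succ]
      _ ≤ ∏ n ∈ Finset.range (minimalPeriod σ i), a * x (σ^[n] i) :=
          Finset.prod_le_prod (fun n _ => mul_nonneg (hf _) (hx _).le) fun n _ => by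
            rw [iterate_succ_apply']; exact h _
      _ = _ := by rw [Finset.prod_mul_distrib, Finset.prod_const, Finset.card_range]
  rw [geomMean_periodicOrbit, one_div]
  calc _ ≤ (a ^ minimalPeriod σ i) ^ ((minimalPeriod σ i : ℝ)⁻¹) :=
        Real.rpow_le_rpow (Finset.prod_nonneg fun n _ => hf _) key (by positivity)
    _ = a := Real.pow_rpow_inv_natCast ha hp.ne'

end Cycle

namespace Digraph

open Function

variable {V : Type*} {G : Digraph V}

theorem finite_circuits [Finite V] (G : Digraph V) : G.circuits.Finite := by
  classical
  have := Fintype.ofFinite V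
  have h : {c : Cycle V | c.Nodup}.Finite :=
    Set.finite_coe_iff.1 (inferInstanceAs (Finite {c : Cycle V // c.Nodup}))
  exact h.subset fun c hc => hc.2.1

theorem periodicOrbit_mem_circuits {σ : V → V} (hσ : ∀ i, G.Adj i (σ i)) {i : V}
    (hi : i ∈ periodicPts σ) : periodicOrbit σ i ∈ G.circuits := by
  refine ⟨fun h => periodicOrbit_eq_nil_iff_not_periodic_pt.1 h hi, nodup_periodicOrbit, ?_⟩
  rw [periodicOrbit_chain' _ hi]
  intro n
  rw [iterate_succ_apply']
  exact hσ _

end Digraph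

/-! ### Circuit bounds for the eigenvalues of a tensor -/

namespace Tensor

open Function

variable {m : ℕ} {ι : Type*} [Fintype ι]

/-- The row sum of the moduli of the entries of a tensor. -/
noncomputable def rowSum (A : Tensor ℂ m ι) (i : ι) : ℝ := ∑ g, ‖A i g‖

theorem ofReal_rowSum {A : Tensor ℂ m ι} (hnn : ∀ i g, A i g = (‖A i g‖ : ℂ)) (i : ι) :
    (A.rowSum i : ℂ) = A.applyVec (fun _ => 1) i := by
  rw [rowSum, applyVec, Complex.ofReal_sum]
  refine Finset.sum_congr rfl fun g _ => ?_
  rw [← hnn i g, Finset.prod_const_one, mul_one]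

theorem exists_adj_of_rowSum_pos {A : Tensor ℂ m ι} (hm : 2 ≤ m) {i : ι} (h : 0 < A.rowSum i) :
    ∃ j, A.digraph.Adj i j := by
  obtain ⟨g, -, hg⟩ := Finset.exists_ne_zero_of_sum_ne_zero h.ne'
  exact ⟨g ⟨0, by omega⟩, g, norm_ne_zero_iff.1 hg, _, rfl⟩

/-- Following out-neighbours at which the modulus of the eigenvector is largest leads to a circuit
that bounds the eigenvalue from above. -/
theorem exists_circuit_le_geomMean {A : Tensor ℂ m ι} (hm : 2 ≤ m) (hA : ∀ i, 0 < A.rowSum i)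
    {μ : ℂ} (hμ : A.IsEigenvalue μ) :
    ∃ γ ∈ A.digraph.circuits, ‖μ‖ ≤ γ.geomMean A.rowSum := by
  obtain ⟨x, hx, hev⟩ := hμ
  have hσ : ∀ i, ∃ j, A.digraph.Adj i j ∧ ∀ l, A.digraph.Adj i l → ‖x l‖ ≤ ‖x j‖ := fun i =>
    Set.exists_max_image {j | A.digraph.Adj i j} (fun j => ‖x j‖) (Set.toFinite _)
      (exists_adj_of_rowSum_pos hm (hA i))
  choose σ hadj hmax using hσ
  have hle : ∀ i, ‖μ‖ * ‖x i‖ ^ (m - 1) ≤ A.rowSum i * ‖x (σ i)‖ ^ (m - 1) := by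
    intro i
    rw [← norm_pow, ← norm_mul, ← hev i, applyVec, rowSum, Finset.sum_mul]
    refine (norm_sum_le _ _).trans (Finset.sum_le_sum fun g _ => ?_)
    rw [norm_mul, norm_prod]
    by_cases hg : A i g = 0
    · simp [hg]
    refine mul_le_mul_of_nonneg_left ?_ (norm_nonneg _)
    calc ∏ j, ‖x (g j)‖ ≤ ∏ _j : Fin (m - 1), ‖x (σ i)‖ :=
          Finset.prod_le_prod (fun _ _ => norm_nonneg _)
            fun j _ => hmax i _ ⟨g, hg, j, rfl⟩
      _ = _ := by simp
  obtain ⟨i, hi⟩ := Function.ne_iff.1 hx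
  -- For `μ = 0` the iterates of `σ` may meet zero coordinates, but every circuit will do.
  obtain hμ0 | hμ0 := (norm_nonneg μ).eq_or_lt
  · obtain ⟨n, hn⟩ := exists_mem_periodicPts_iterate σ i
    exact ⟨_, Digraph.periodicOrbit_mem_circuits hadj hn,
      hμ0 ▸ Cycle.geomMean_nonneg fun j => (hA j).le⟩
  have hpos : ∀ n, 0 < ‖x (σ^[n] i)‖ := by
    intro n
    induction n with
    | zero => exact norm_pos_iff.2 hi
    | succ n ih =>
      rw [iterate_succ_apply']
      refine (norm_nonneg _).lt_of_ne fun h0 => ?_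
      have := hle (σ^[n] i)
      rw [← h0, zero_pow (by omega), mul_zero] at this
      exact absurd this (not_le.2 (by positivity))
  obtain ⟨n, hn⟩ := exists_mem_periodicPts_iterate σ i
  refine ⟨_, Digraph.periodicOrbit_mem_circuits hadj hn,
    Cycle.le_geomMean_periodicOrbit (x := fun j => ‖x j‖ ^ (m - 1)) hn hμ0.le ?_ ?_⟩
  · intro l
    rw [← iterate_add_apply]
    exact pow_pos (hpos _) _
  · intro l
    rw [iterate_succ_apply']
    exact hle _

/-- Following out-neighbours at which the positive eigenvector is smallest leads to a circuit that
bounds the eigenvalue from below. -/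
theorem exists_circuit_geomMean_le [Nonempty ι] {A : Tensor ℂ m ι} (hm : 2 ≤ m)
    (hA : ∀ i, 0 < A.rowSum i) (hnn : ∀ i g, A i g = (‖A i g‖ : ℂ)) {x : ι → ℝ}
    (hx : ∀ i, 0 < x i) {μ : ℝ} (hev : ∀ i, A.applyVec (fun j => (x j : ℂ)) i = μ * x i ^ (m - 1)) :
    0 ≤ μ ∧ ∃ γ ∈ A.digraph.circuits, γ.geomMean A.rowSum ≤ μ := by
  have hσ : ∀ i, ∃ j, A.digraph.Adj i j ∧ ∀ l, A.digraph.Adj i l → x j ≤ x l := fun i =>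
    Set.exists_min_image {j | A.digraph.Adj i j} x (Set.toFinite _)
      (exists_adj_of_rowSum_pos hm (hA i))
  choose σ hadj hmin using hσ
  have hev' : ∀ i, ∑ g, ‖A i g‖ * ∏ j, x (g j) = μ * x i ^ (m - 1) := by
    intro i
    have h := hev i
    rw [applyVec, Finset.sum_congr rfl fun g _ => by rw [hnn i g]] at h
    exact_mod_cast h
  have hle : ∀ i, A.rowSum i * x (σ i) ^ (m - 1) ≤ μ * x i ^ (m - 1) := by
    intro i
    rw [← hev' i, rowSum, Finset.sum_mul]
    refine Finset.sum_le_sum fun g _ => ?_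
    by_cases hg : A i g = 0
    · simp [hg]
    refine mul_le_mul_of_nonneg_left ?_ (norm_nonneg _)
    calc x (σ i) ^ (m - 1) = ∏ _j : Fin (m - 1), x (σ i) := by simp
      _ ≤ ∏ j, x (g j) :=
          Finset.prod_le_prod (fun _ _ => (hx _).le) fun j _ => hmin i _ ⟨g, hg, j, rfl⟩
  obtain ⟨i⟩ := ‹Nonempty ι›
  have hμ : 0 ≤ μ := by
    refine nonneg_of_mul_nonneg_left ?_ (pow_pos (hx i) (m - 1))
    exact (mul_nonneg (hA i).le (pow_nonneg (hx _).le _)).trans (hle i)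
  obtain ⟨n, hn⟩ := exists_mem_periodicPts_iterate σ i
  exact ⟨hμ, _, Digraph.periodicOrbit_mem_circuits hadj hn,
    Cycle.geomMean_periodicOrbit_le (x := fun j => x j ^ (m - 1)) hn hμ (fun j => (hA j).le)
      (fun j => pow_pos (hx j) _) hle⟩

theorem exists_isLeast_isGreatest_spectralRadius [Nonempty ι] {A : Tensor ℂ m ι} (hm : 2 ≤ m)
    (hA : ∀ i, 0 < A.rowSum i) (hnn : ∀ i g, A i g = (‖A i g‖ : ℂ)) {x : ι → ℝ}
    (hx : ∀ i, 0 < x i) {μ : ℝ} (hev : ∀ i, A.applyVec (fun j => (x j : ℂ)) i = μ * x i ^ (m - 1)) :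
    ∃ lo hi : ℝ,
      IsLeast ((fun γ : Cycle ι => γ.geomMean A.rowSum) '' A.digraph.circuits) lo ∧
      IsGreatest ((fun γ : Cycle ι => γ.geomMean A.rowSum) '' A.digraph.circuits) hi ∧
      lo ≤ A.spectralRadius ∧ A.spectralRadius ≤ hi := by
  obtain ⟨hμ, γ, hγ, hγμ⟩ := exists_circuit_geomMean_le hm hA hnn hx hev
  have hfin := (A.digraph.finite_circuits).image (fun γ : Cycle ι => γ.geomMean A.rowSum)
  have hne : ((fun γ : Cycle ι => γ.geomMean A.rowSum) '' A.digraph.circuits).Nonempty :=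
    ⟨_, γ, hγ, rfl⟩
  obtain ⟨lo, hlo⟩ := hfin.isCompact.exists_isLeast hne
  obtain ⟨hi, hhi⟩ := hfin.isCompact.exists_isGreatest hne
  have hub : ∀ r ∈ {r : ℝ | ∃ μ : ℂ, A.IsEigenvalue μ ∧ r = ‖μ‖}, r ≤ hi := by
    rintro r ⟨ν, hν, rfl⟩
    obtain ⟨δ, hδ, h⟩ := exists_circuit_le_geomMean hm hA hν
    exact h.trans (hhi.2 ⟨δ, hδ, rfl⟩)
  have hmem : μ ∈ {r : ℝ | ∃ μ : ℂ, A.IsEigenvalue μ ∧ r = ‖μ‖} := by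
    refine ⟨μ, ⟨fun j => x j, ?_, hev⟩, by simp [abs_of_nonneg hμ]⟩
    obtain ⟨i⟩ := ‹Nonempty ι›
    exact Function.ne_iff.2 ⟨i, by simpa using (hx i).ne'⟩
  exact ⟨lo, hi, hlo, hhi, ((hlo.2 ⟨γ, hγ, rfl⟩).trans hγμ).trans (le_csSup ⟨hi, hub⟩ hmem),
    csSup_le ⟨μ, hmem⟩ hub⟩

end Tensor

/-! ### A positive eigenvector by maximisation -/

section PositiveEigenvector

variable {V : Type*} [Fintype V] [DecidableEq V] {E : Finset (Finset V)} {k : ℕ}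

/-- For connected `E`, a maximiser of `∑ s ∈ E, ∏ j ∈ s, y j + ∑ i, v i * y i ^ k` over nonnegative
`y`, nonzero and with maximum value `0`, has no zero coordinate. Connectedness is expressed as: a
property that spreads within the members of `E` and holds somewhere holds everywhere. -/
theorem pos_of_isMaxOn_zero (hE : ∀ s ∈ E, s.card = k)
    (hconn : ∀ p : V → Prop, (∃ i, p i) → (∀ s ∈ E, ∀ i ∈ s, ∀ j ∈ s, p i → p j) → ∀ j, p j)
    {v x : V → ℝ} (hx : ∀ i, 0 ≤ x i) (hx0 : x ≠ 0)
    (hmax : ∀ y : V → ℝ, (∀ i, 0 ≤ y i) → ∑ s ∈ E, ∏ j ∈ s, y j + ∑ i, v i * y i ^ k ≤ 0)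
    (heq : ∑ s ∈ E, ∏ j ∈ s, x j + ∑ i, v i * x i ^ k = 0) (i : V) : 0 < x i := by
  suffices h : ∀ j, x j ≠ 0 from (hx i).lt_of_ne (h i).symm
  by_contra! hz
  obtain ⟨e, he, a, ha, b, hb, hxa, hxb⟩ :
      ∃ e ∈ E, ∃ a ∈ e, ∃ b ∈ e, x a ≠ 0 ∧ x b = 0 := by
    by_contra! hno
    obtain ⟨j, hj⟩ := hz
    exact hconn (fun i => x i ≠ 0) (Function.ne_iff.1 hx0) hno j hj
  have hk : k ≠ 0 := by
    rw [← hE e he]; exact Finset.card_ne_zero_of_mem ha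
  set c := ∏ j ∈ e with x j ≠ 0, x j with hc
  set W := ∑ i with x i = 0, v i with hW
  have hcpos : 0 < c := Finset.prod_pos fun j hj =>
    (hx j).lt_of_ne (Finset.mem_filter.1 hj).2.symm
  -- With this `ε ≤ 1`, the gain `c * ε ^ (k - 1)` exceeds the possible loss `|W| * ε ^ k`.
  set ε := c / (c + |W| + 1) with hε
  have hden : 0 < c + |W| + 1 := by positivity
  have hεpos : 0 < ε := by positivity
  have hε1 : ε ≤ 1 := (div_le_one hden).2 (by linarith [abs_nonneg W])
  let y : V → ℝ := fun j => if x j = 0 then ε else x j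
  have hxy : ∀ j, x j ≤ y j := by
    intro j
    simp only [y]
    split_ifs with h
    · rw [h]; exact hεpos.le
    · exact le_rfl
  have hy : ∀ j, 0 ≤ y j := fun j => (hx j).trans (hxy j)
  have hedge : c * ε ^ (k - 1) ≤ ∏ j ∈ e, y j := by
    have hsplit : ∏ j ∈ e, y j = ε ^ (e.filter fun j => x j = 0).card * c := by
      simp only [y]
      rw [Finset.prod_ite, Finset.prod_const]
    have hlt : (e.filter fun j => x j = 0).card < e.card :=
      Finset.card_lt_card (Finset.filter_ssubset.2 ⟨a, ha, hxa⟩)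
    rw [hE e he] at hlt
    rw [hsplit, mul_comm]
    exact mul_le_mul_of_nonneg_right (pow_le_pow_of_le_one hεpos.le hε1 (by omega)) hcpos.le
  have hsum : ∑ s ∈ E, ∏ j ∈ s, x j + c * ε ^ (k - 1) ≤ ∑ s ∈ E, ∏ j ∈ s, y j := by
    rw [← Finset.add_sum_erase _ _ he, ← Finset.add_sum_erase _ (fun s => ∏ j ∈ s, y j) he,
      Finset.prod_eq_zero hb hxb]
    have : ∑ s ∈ E.erase e, ∏ j ∈ s, x j ≤ ∑ s ∈ E.erase e, ∏ j ∈ s, y j :=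
      Finset.sum_le_sum fun s _ => Finset.prod_le_prod (fun j _ => hx j) fun j _ => hxy j
    linarith
  have hpow : ∑ i, v i * y i ^ k = ∑ i, v i * x i ^ k + W * ε ^ k := by
    rw [hW, Finset.sum_filter, Finset.sum_mul, ← Finset.sum_add_distrib]
    refine Finset.sum_congr rfl fun j _ => ?_
    simp only [y]
    split_ifs with h <;> simp [h, hk]
  have hfin := hmax y hy
  have hεk : ε ^ k = ε * ε ^ (k - 1) := (mul_pow_sub_one hk ε).symm
  have h1 : (c + W * ε) * ε ^ (k - 1) ≤ 0 := by
    rw [hpow, hεk] at hfin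
    linarith
  have h2 : 0 < c + W * ε := by
    have h3 : |W| * ε < c := by
      rw [hε, mul_div_assoc', div_lt_iff₀ hden]
      nlinarith [abs_nonneg W]
    have h4 : -(|W| * ε) ≤ W * ε := by
      rw [← neg_mul]
      exact mul_le_mul_of_nonneg_right (neg_abs_le W) hεpos.le
    linarith
  exact absurd h1 (not_le.2 (by positivity))

/-- At a positive maximiser the partial derivatives vanish. The functional is affine in `y i` apart
from the term `v i * y i ^ k`, so the derivative is that of a one-variable polynomial. -/
theorem sum_prod_erase_of_isMaxOn_zero {v x : V → ℝ} (hx : ∀ i, 0 < x i)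
    (hmax : ∀ y : V → ℝ, (∀ i, 0 ≤ y i) → ∑ s ∈ E, ∏ j ∈ s, y j + ∑ i, v i * y i ^ k ≤ 0)
    (heq : ∑ s ∈ E, ∏ j ∈ s, x j + ∑ i, v i * x i ^ k = 0) (i : V) :
    ∑ s ∈ E with i ∈ s, ∏ j ∈ s.erase i, x j + v i * (k * x i ^ (k - 1)) = 0 := by
  set a := ∑ s ∈ E with i ∈ s, ∏ j ∈ s.erase i, x j
  set b := ∑ s ∈ E with i ∉ s, ∏ j ∈ s, x j + ∑ j ∈ Finset.univ.erase i, v j * x j ^ k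
  have hform : ∀ t : ℝ, ∑ s ∈ E, ∏ j ∈ s, Function.update x i t j +
      ∑ j, v j * Function.update x i t j ^ k = a * t + v i * t ^ k + b := by
    intro t
    have h1 : ∑ s ∈ E with i ∈ s, ∏ j ∈ s, Function.update x i t j = a * t := by
      rw [Finset.sum_mul]
      refine Finset.sum_congr rfl fun s hs => ?_
      rw [← Finset.mul_prod_erase _ _ (Finset.mem_filter.1 hs).2, Function.update_self, mul_comm]
      congr 1
      exact Finset.prod_congr rfl fun j hj =>
        Function.update_of_ne (Finset.ne_of_mem_erase hj) _ _
    have h2 : ∑ s ∈ E with i ∉ s, ∏ j ∈ s, Function.update x i t j =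
        ∑ s ∈ E with i ∉ s, ∏ j ∈ s, x j :=
      Finset.sum_congr rfl fun s hs => Finset.prod_congr rfl fun j hj =>
        Function.update_of_ne (ne_of_mem_of_not_mem hj (Finset.mem_filter.1 hs).2) _ _
    have h3 : ∑ j ∈ Finset.univ.erase i, v j * Function.update x i t j ^ k =
        ∑ j ∈ Finset.univ.erase i, v j * x j ^ k :=
      Finset.sum_congr rfl fun j hj => by
        rw [Function.update_of_ne (Finset.ne_of_mem_erase hj)]
    rw [← Finset.sum_filter_add_sum_filter_not E (fun s => i ∈ s), h1, h2,
      ← Finset.add_sum_erase _ _ (Finset.mem_univ i), h3, Function.update_self]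
    ring
  have hloc : IsLocalMax (fun t : ℝ => a * t + v i * t ^ k + b) (x i) := by
    filter_upwards [eventually_gt_nhds (hx i)] with t ht
    have h0 := hform (x i)
    rw [Function.update_eq_self, heq] at h0
    rw [← h0, ← hform t]
    refine hmax _ fun j => ?_
    by_cases hj : j = i
    · subst hj; simpa using ht.le
    · simpa [hj] using (hx j).le
  have hder : HasDerivAt (fun t : ℝ => a * t + v i * t ^ k + b)
      (a * 1 + v i * (k * x i ^ (k - 1))) (x i) :=
    (((hasDerivAt_id' (x i)).const_mul a).add ((hasDerivAt_pow k (x i)).const_mul (v i))).add_const b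
  simpa using hloc.hasDerivAt_eq_zero hder

/-- A maximiser on the simplex of the quotient of `∑ s ∈ E, ∏ j ∈ s, y j + ∑ i, w i * y i ^ k` by
`∑ i, y i ^ k`, and the maximum `M`. Both forms are homogeneous of degree `k`, so the inequality
extends from the simplex to all nonnegative `y`. -/
theorem exists_isMaxOn_zero [Nonempty V] (hk : k ≠ 0) (hE : ∀ s ∈ E, s.card = k) (w : V → ℝ) :
    ∃ (M : ℝ) (x : V → ℝ), (∀ i, 0 ≤ x i) ∧ x ≠ 0 ∧
      (∀ y : V → ℝ, (∀ i, 0 ≤ y i) →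
        ∑ s ∈ E, ∏ j ∈ s, y j + ∑ i, (w i - M) * y i ^ k ≤ 0) ∧
      ∑ s ∈ E, ∏ j ∈ s, x j + ∑ i, (w i - M) * x i ^ k = 0 := by
  let F : (V → ℝ) → ℝ := fun y => ∑ s ∈ E, ∏ j ∈ s, y j + ∑ i, w i * y i ^ k
  let N : (V → ℝ) → ℝ := fun y => ∑ i, y i ^ k
  have hsplit : ∀ (M : ℝ) (y : V → ℝ),
      ∑ s ∈ E, ∏ j ∈ s, y j + ∑ i, (w i - M) * y i ^ k = F y - M * N y := by
    intro M y
    simp only [F, N, sub_mul, Finset.sum_sub_distrib, Finset.mul_sum]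
    ring
  have hne0 : ∀ y ∈ stdSimplex ℝ V, y ≠ 0 := by
    rintro y hy rfl
    simpa using hy.2
  have hNpos : ∀ y ∈ stdSimplex ℝ V, 0 < N y := by
    intro y hy
    obtain ⟨i, hi⟩ := Function.ne_iff.1 (hne0 y hy)
    exact Finset.sum_pos' (fun j _ => pow_nonneg (hy.1 j) k)
      ⟨i, Finset.mem_univ i, pow_pos ((hy.1 i).lt_of_ne (Ne.symm hi)) k⟩
  have hcont : ContinuousOn (fun y => F y / N y) (stdSimplex ℝ V) := by
    refine ContinuousOn.div (Continuous.continuousOn ?_) (Continuous.continuousOn ?_)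
      fun y hy => (hNpos y hy).ne'
    · fun_prop
    · fun_prop
  obtain ⟨x, hx, hmax⟩ := (isCompact_stdSimplex ℝ V).exists_isMaxOn
    ⟨_, single_mem_stdSimplex ℝ (Classical.arbitrary V)⟩ hcont
  refine ⟨F x / N x, x, hx.1, hne0 x hx, fun y hy => ?_, ?_⟩
  · rw [hsplit, sub_nonpos]
    obtain hs | hs := (Finset.sum_nonneg fun i (_ : i ∈ Finset.univ) => hy i).eq_or_lt
    · have hy0 : y = 0 := funext fun i =>
        (Finset.sum_eq_zero_iff_of_nonneg fun i _ => hy i).1 hs.symm i (Finset.mem_univ i)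
      have hF : F 0 = 0 := by
        simp only [F, Pi.zero_apply, zero_pow hk, mul_zero, Finset.sum_const_zero, add_zero]
        refine Finset.sum_eq_zero fun s hs => ?_
        rw [Finset.prod_const, hE s hs, zero_pow hk]
      have hN : N 0 = 0 := by simp [N, hk]
      rw [hy0, hF, hN, mul_zero]
    · set t := ∑ i, y i
      let z : V → ℝ := fun i => y i / t
      have hyz : ∀ i, y i = t * z i := fun i => (mul_div_cancel₀ _ hs.ne').symm
      have hz : z ∈ stdSimplex ℝ V :=
        ⟨fun i => div_nonneg (hy i) hs.le, by
          rw [← Finset.sum_div]; exact div_self hs.ne'⟩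
      have hFz : F y = t ^ k * F z := by
        simp only [F, hyz, mul_add, Finset.mul_sum]
        congr 1
        · refine Finset.sum_congr rfl fun s hs => ?_
          rw [Finset.prod_mul_distrib, Finset.prod_const, hE s hs]
        · exact Finset.sum_congr rfl fun i _ => by ring
      have hNz : N y = t ^ k * N z := by
        simp only [N, hyz, Finset.mul_sum, mul_pow]
      have hle : F z ≤ F x / N x * N z := (div_le_iff₀ (hNpos z hz)).1 (hmax hz)
      rw [hFz, hNz, mul_left_comm]
      exact mul_le_mul_of_nonneg_left hle (by positivity)
  · rw [hsplit, div_mul_cancel₀ _ (hNpos x hx).ne', sub_self]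

/-- A positive solution of the eigenvalue equations of the hypergraph with edges `E` and diagonal
weights `w`. -/
theorem exists_pos_eigenvector [Nonempty V] (hk : k ≠ 0) (hE : ∀ s ∈ E, s.card = k)
    (hconn : ∀ p : V → Prop, (∃ i, p i) → (∀ s ∈ E, ∀ i ∈ s, ∀ j ∈ s, p i → p j) → ∀ j, p j)
    (w : V → ℝ) :
    ∃ (μ : ℝ) (x : V → ℝ), (∀ i, 0 < x i) ∧
      ∀ i, w i * x i ^ (k - 1) + ∑ s ∈ E with i ∈ s, ∏ j ∈ s.erase i, x j = μ * x i ^ (k - 1) := by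
  -- The factor `1 / k` cancels the exponent that differentiating `x i ^ k` brings down.
  obtain ⟨M, x, hx, hx0, hmax, heq⟩ := exists_isMaxOn_zero hk hE fun i => w i / k
  have hpos := pos_of_isMaxOn_zero hE hconn hx hx0 hmax heq
  refine ⟨k * M, x, hpos, fun i => ?_⟩
  have h := sum_prod_erase_of_isMaxOn_zero hpos hmax heq i
  have hk' : (k : ℝ) ≠ 0 := Nat.cast_ne_zero.2 hk
  field_simp at h
  linarith

end PositiveEigenvector

/-! ### The tensors of a hypergraph -/

/-- Each of the `n!` enumerations of the `n`-element set `t` contributes the same product. -/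
theorem sum_filter_image_eq_prod {V : Type*} [Fintype V] [DecidableEq V] {n : ℕ} {t : Finset V}
    (ht : t.card = n) (x : V → ℂ) :
    ∑ g : Fin n → V with Finset.univ.image g = t, ∏ j, x (g j) = (n ! : ℂ) * ∏ j ∈ t, x j := by
  have hinj : ∀ g : Fin n → V, Finset.univ.image g = t → Function.Injective g := fun g hg => by
      have h := Finset.card_image_iff (s := Finset.univ) (f := g)
      rw [hg, ht, Finset.card_fin, Finset.coe_univ, Set.injOn_univ] at h
      exact h.1 rfl
  have hterm : ∀ g ∈ (Finset.univ : Finset (Fin n → V)).filter (fun g => Finset.univ.image g = t),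
      ∏ j, x (g j) = ∏ j ∈ t, x j := by
    intro g hg
    have hg := (Finset.mem_filter.1 hg).2
    rw [← hg, Finset.prod_image (hinj g hg).injOn]
  rw [Finset.sum_congr rfl hterm, Finset.sum_const, nsmul_eq_mul]
  congr 2
  have e : Fin n ≃ t := (Finset.equivFinOfCardEq ht).symm
  have hcard : Fintype.card (Fin n ≃ t) = n ! := by
    rw [Fintype.card_equiv e, Fintype.card_fin]
  rw [← hcard, ← Finset.card_univ]
  refine (Finset.card_bij (fun f _ j => (f j : V)) ?_ ?_ ?_).symm
  · intro f _
    refine Finset.mem_filter.2 ⟨Finset.mem_univ _, ?_⟩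
    ext v
    simp only [Finset.mem_image, Finset.mem_univ, true_and]
    refine ⟨?_, fun hv => ⟨f.symm ⟨v, hv⟩, by simp⟩⟩
    rintro ⟨j, rfl⟩
    exact (f j).2
  · intro f _ f' _ h
    ext j
    exact congrFun h j
  · intro g hg
    have hg := (Finset.mem_filter.1 hg).2
    have hmem : ∀ j, g j ∈ t := fun j => hg ▸ Finset.mem_image_of_mem g (Finset.mem_univ j)
    have hb : Function.Bijective fun j => (⟨g j, hmem j⟩ : t) := by
      rw [Fintype.bijective_iff_injective_and_card]
      refine ⟨fun a b h => hinj g hg (congrArg Subtype.val h), by simp [ht]⟩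
    exact ⟨Equiv.ofBijective _ hb, Finset.mem_univ _, rfl⟩

namespace Hypergraph

variable {α : Type*} {H : Hypergraph α} {k : ℕ}

/-- The entries are nonnegative reals. -/
theorem adjacencyTensor_eq_norm (i : H.vertexSet) (g : Fin (k - 1) → H.vertexSet) :
    H.adjacencyTensor k i g = (‖H.adjacencyTensor k i g‖ : ℂ) := by
  rw [adjacencyTensor]
  split_ifs <;> simp

open scoped ComplexOrder in
/-- The entries are nonnegative reals. -/
theorem signlessLaplacianTensor_eq_norm (i : H.vertexSet) (g : Fin (k - 1) → H.vertexSet) :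
    H.signlessLaplacianTensor k i g = (‖H.signlessLaplacianTensor k i g‖ : ℂ) := by
  have h : 0 ≤ H.signlessLaplacianTensor k i g := by
    simp only [signlessLaplacianTensor, degreeTensor, adjacencyTensor, Pi.add_apply]
    refine add_nonneg ?_ ?_ <;> split_ifs <;> positivity
  exact Complex.eq_coe_norm_of_nonneg h

variable [Fintype H.vertexSet]

open Classical in
/-- The edges of a hypergraph with finite vertex set, as finite sets of vertices. -/
noncomputable def edges (H : Hypergraph α) [Fintype H.vertexSet] : Finset (Finset H.vertexSet) :=
  Finset.univ.filter fun s => Subtype.val '' (s : Set H.vertexSet) ∈ H.edgeSet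

theorem mem_edges {s : Finset H.vertexSet} :
    s ∈ H.edges ↔ Subtype.val '' (s : Set H.vertexSet) ∈ H.edgeSet := by
  simp [edges]

theorem exists_mem_edges {e : Set α} (he : e ∈ H.edgeSet) :
    ∃ s ∈ H.edges, Subtype.val '' (s : Set H.vertexSet) = e := by
  classical
  have h : Subtype.val '' (((Subtype.val ⁻¹' e : Set H.vertexSet).toFinset : Finset H.vertexSet) :
      Set H.vertexSet) = e := by
    rw [Set.coe_toFinset, Subtype.image_preimage_coe]
    exact Set.inter_eq_right.2 (H.subset_vertexSet_of_mem_edgeSet he)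
  exact ⟨_, mem_edges.2 (h.symm ▸ he), h⟩

theorem IsUniform.card_edges (hunif : H.IsUniform k) {s : Finset H.vertexSet} (hs : s ∈ H.edges) :
    s.card = k := by
  have h := hunif _ (mem_edges.1 hs)
  rw [Subtype.val_injective.encard_image, Set.encard_coe_eq_coe_finsetCard] at h
  exact_mod_cast h

open Classical in
theorem card_filter_mem_edges (i : H.vertexSet) :
    (H.edges.filter fun s => i ∈ s).card = H.degree i := by
  rw [degree, ← Set.ncard_coe_finset,
    ← Set.ncard_image_of_injective (f := fun s : Finset H.vertexSet =>
      Subtype.val '' (s : Set H.vertexSet)) _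
      (Subtype.val_injective.image_injective.comp Finset.coe_injective)]
  congr 1
  ext e
  simp only [Set.mem_image, Finset.coe_filter, Set.mem_ofPred_eq]
  constructor
  · rintro ⟨s, ⟨hs, hi⟩, rfl⟩
    exact ⟨mem_edges.1 hs, i, hi, rfl⟩
  · rintro ⟨he, hi⟩
    obtain ⟨s, hs, rfl⟩ := exists_mem_edges he
    obtain ⟨j, hj, hji⟩ := hi
    exact ⟨s, ⟨hs, Subtype.ext hji ▸ hj⟩, rfl⟩

theorem IsConnected.forall_of_forall_edges (hconn : H.IsConnected) (p : H.vertexSet → Prop)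
    (hp : ∃ i, p i) (hstep : ∀ s ∈ H.edges, ∀ i ∈ s, ∀ j ∈ s, p i → p j) (j : H.vertexSet) :
    p j := by
  obtain ⟨i, hi⟩ := hp
  have h : ∀ v, Relation.ReflTransGen H.Adj i v → ∃ hv : v ∈ H.vertexSet, p ⟨v, hv⟩ := by
    intro v hv
    induction hv with
    | refl => exact ⟨i.2, hi⟩
    | tail _ hadj ih =>
      obtain ⟨hb, hpb⟩ := ih
      obtain ⟨e, he, hbe, hce⟩ := hadj
      have hc := H.mem_vertexSet_of_mem_edgeSet he hce
      obtain ⟨s, hs, rfl⟩ := exists_mem_edges he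
      obtain ⟨b', hb', rfl⟩ := hbe
      obtain ⟨c', hc', rfl⟩ := hce
      exact ⟨hc, hstep s hs _ hb' _ hc' hpb⟩
  exact (h j (hconn.2 i i.2 j j.2)).2

theorem IsConnected.degree_pos (hconn : H.IsConnected) (hk : 2 ≤ k) (hunif : H.IsUniform k)
    (hne : H.edgeSet.Nonempty) (i : H.vertexSet) : 0 < H.degree i := by
  classical
  refine hconn.forall_of_forall_edges (fun i => 0 < H.degree i) ?_ ?_ i
  · obtain ⟨e, he⟩ := hne
    obtain ⟨s, hs, -⟩ := exists_mem_edges he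
    obtain ⟨i, hi⟩ := Finset.card_pos.1 (by rw [hunif.card_edges hs]; omega)
    refine ⟨i, ?_⟩
    rw [← card_filter_mem_edges]
    exact Finset.card_pos.2 ⟨s, Finset.mem_filter.2 ⟨hs, hi⟩⟩
  · intro s hs _ _ j hj _
    rw [← card_filter_mem_edges]
    exact Finset.card_pos.2 ⟨s, Finset.mem_filter.2 ⟨hs, hj⟩⟩

open Classical in
theorem IsUniform.adjacencyTensor_applyVec (hunif : H.IsUniform k) (x : H.vertexSet → ℂ)
    (i : H.vertexSet) :
    (H.adjacencyTensor k).applyVec x i =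
      ∑ s ∈ H.edges with i ∈ s, ∏ j ∈ s.erase i, x j := by
  have hcard : ∀ s ∈ H.edges.filter (fun s => i ∈ s), (s.erase i).card = k - 1 := fun s hs => by
    rw [Finset.card_erase_of_mem (Finset.mem_filter.1 hs).2,
      hunif.card_edges (Finset.mem_filter.1 hs).1]
  have hentry : ∀ g : Fin (k - 1) → H.vertexSet, H.adjacencyTensor k i g =
      ∑ s ∈ H.edges with i ∈ s,
        if Finset.univ.image g = s.erase i then 1 / ((k - 1)! : ℂ) else 0 := by
    intro g
    have hset : Subtype.val '' ((insert i (Finset.univ.image g) : Finset H.vertexSet) :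
        Set H.vertexSet) = insert (i : α) (Set.range fun j => (g j : α)) := by
      rw [Finset.coe_insert, Set.image_insert_eq, Finset.coe_image, Finset.coe_univ,
        Set.image_univ, ← Set.range_comp]
      rfl
    -- An edge `s ∋ i` equals `{i} ∪ {g j}` iff the `g j` exhaust `s \ {i}`: since `s` has `k`
    -- elements, the `k - 1` entries of `g` cannot cover `i` as well.
    have hiff : ∀ s ∈ H.edges.filter (fun s => i ∈ s),
        Finset.univ.image g = s.erase i ↔ s = insert i (Finset.univ.image g) := by
      intro s hs
      constructor
      · intro h
        rw [h, Finset.insert_erase (Finset.mem_filter.1 hs).2]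
      · intro h
        refine (Finset.eq_of_subset_of_card_le ?_ ?_).symm
        · rw [h]
          exact Finset.erase_insert_subset _ _
        · rw [hcard s hs]
          exact Finset.card_image_le.trans (Finset.card_fin _).le
    rw [Finset.sum_congr rfl fun s hs => if_congr (hiff s hs) rfl rfl, Finset.sum_ite_eq',
      adjacencyTensor]
    refine if_congr ?_ rfl rfl
    rw [Finset.mem_filter, mem_edges, hset]
    simp
  have hfac : ((k - 1)! : ℂ) ≠ 0 := Nat.cast_ne_zero.2 (Nat.factorial_ne_zero _)
  simp only [Tensor.applyVec, hentry, Finset.sum_mul]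
  rw [Finset.sum_comm]
  refine Finset.sum_congr rfl fun s hs => ?_
  simp only [ite_mul, zero_mul]
  rw [← Finset.sum_filter, ← Finset.mul_sum, sum_filter_image_eq_prod (hcard s hs), one_div,
    inv_mul_cancel_left₀ hfac]

theorem degreeTensor_applyVec (x : H.vertexSet → ℂ) (i : H.vertexSet) :
    (H.degreeTensor k).applyVec x i = H.degree i * x i ^ (k - 1) := by
  classical
  rw [Tensor.applyVec, Finset.sum_eq_single fun _ => i]
  · simp [degreeTensor]
  · intro g _ hg
    rw [degreeTensor, if_neg fun h => hg (funext h), zero_mul]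
  · simp

open Classical in
theorem IsUniform.signlessLaplacianTensor_applyVec (hunif : H.IsUniform k) (x : H.vertexSet → ℂ)
    (i : H.vertexSet) :
    (H.signlessLaplacianTensor k).applyVec x i = H.degree i * x i ^ (k - 1) +
      ∑ s ∈ H.edges with i ∈ s, ∏ j ∈ s.erase i, x j := by
  have h : (H.signlessLaplacianTensor k).applyVec x i =
      (H.degreeTensor k).applyVec x i + (H.adjacencyTensor k).applyVec x i := by
    simp only [Tensor.applyVec, signlessLaplacianTensor, ← Finset.sum_add_distrib, ← add_mul]
    rfl
  rw [h, degreeTensor_applyVec, hunif.adjacencyTensor_applyVec]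

theorem IsUniform.rowSum_adjacencyTensor (hunif : H.IsUniform k) (i : H.vertexSet) :
    (H.adjacencyTensor k).rowSum i = H.degree i := by
  classical
  have h := Tensor.ofReal_rowSum (adjacencyTensor_eq_norm (H := H) (k := k)) i
  rw [hunif.adjacencyTensor_applyVec] at h
  simp only [Finset.prod_const_one, Finset.sum_const, nsmul_eq_mul, mul_one] at h
  rw [← card_filter_mem_edges]
  exact_mod_cast h

theorem IsUniform.rowSum_signlessLaplacianTensor (hunif : H.IsUniform k) (i : H.vertexSet) :
    (H.signlessLaplacianTensor k).rowSum i = 2 * H.degree i := by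
  classical
  have h := Tensor.ofReal_rowSum (signlessLaplacianTensor_eq_norm (H := H) (k := k)) i
  rw [hunif.signlessLaplacianTensor_applyVec] at h
  simp only [Finset.prod_const_one, Finset.sum_const, nsmul_eq_mul, mul_one, one_pow] at h
  rw [card_filter_mem_edges, ← two_mul] at h
  exact_mod_cast h

end Hypergraph

theorem mainTheorem6 {α : Type*} (H : Hypergraph α) [Fintype H.vertexSet] (k : ℕ) (hk : 2 ≤ k)
    (hunif : H.IsUniform k) (hconn : H.IsConnected) (hne : H.edgeSet.Nonempty) :
    (∃ lo hi : ℝ,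
      IsLeast ((fun γ : Cycle H.vertexSet => γ.geomMean fun i => (H.degree i : ℝ)) ''
        (H.adjacencyTensor k).digraph.circuits) lo ∧
      IsGreatest ((fun γ : Cycle H.vertexSet => γ.geomMean fun i => (H.degree i : ℝ)) ''
        (H.adjacencyTensor k).digraph.circuits) hi ∧
      lo ≤ (H.adjacencyTensor k).spectralRadius ∧
      (H.adjacencyTensor k).spectralRadius ≤ hi) ∧
    (∃ lo hi : ℝ,
      IsLeast ((fun γ : Cycle H.vertexSet => γ.geomMean fun i => 2 * (H.degree i : ℝ)) ''
        (H.signlessLaplacianTensor k).digraph.circuits) lo ∧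
      IsGreatest ((fun γ : Cycle H.vertexSet => γ.geomMean fun i => 2 * (H.degree i : ℝ)) ''
        (H.signlessLaplacianTensor k).digraph.circuits) hi ∧
      lo ≤ (H.signlessLaplacianTensor k).spectralRadius ∧
      (H.signlessLaplacianTensor k).spectralRadius ≤ hi) := by
  classical
  have := hconn.1.to_subtype
  have hd := hconn.degree_pos hk hunif hne
  have hE : ∀ s ∈ H.edges, s.card = k := fun s hs => hunif.card_edges hs
  constructor
  · obtain ⟨μ, x, hx, hev⟩ :=
      exists_pos_eigenvector (by omega) hE hconn.forall_of_forall_edges (fun _ => 0)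
    rw [← funext hunif.rowSum_adjacencyTensor]
    refine Tensor.exists_isLeast_isGreatest_spectralRadius hk (fun i => ?_)
      Hypergraph.adjacencyTensor_eq_norm hx (μ := μ) fun i => ?_
    · rw [hunif.rowSum_adjacencyTensor]
      exact_mod_cast hd i
    · rw [hunif.adjacencyTensor_applyVec]
      have h := hev i
      rw [zero_mul, zero_add] at h
      exact_mod_cast h
  · obtain ⟨μ, x, hx, hev⟩ :=
      exists_pos_eigenvector (by omega) hE hconn.forall_of_forall_edges (fun i => (H.degree i : ℝ))
    rw [← funext hunif.rowSum_signlessLaplacianTensor]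
    refine Tensor.exists_isLeast_isGreatest_spectralRadius hk (fun i => ?_)
      Hypergraph.signlessLaplacianTensor_eq_norm hx (μ := μ) fun i => ?_
    · rw [hunif.rowSum_signlessLaplacianTensor]
      exact mul_pos two_pos (Nat.cast_pos.2 (hd i))
    · rw [hunif.signlessLaplacianTensor_applyVec]
      exact_mod_cast hev i
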